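/- Let $\mathcal H$ be a complex Hilbert space, with inner product $\langle\cdot,\cdot\rangle$ antilinear in the first entry. A (linear) relation is a linear subset $T\subset\mathcal H\oplus\mathcal H$; write $T-\zeta I=\{(f,g-\zeta f):(f,g)\in T\}$, $T^{-1}=\{(g,f):(f,g)\in T\}$, $\ker T=\{f:(f,0)\in T\}$, $T^*=\{(h,k):\langle k,f\rangle=\langle h,g\rangle\ \text{for all }(f,g)\in T\}$ and $N_\zeta(T)=\{(f,\zeta f)\in T\}$. $T$ is selfadjoint if $T=T^*$. A relation is bounded if $\|g\|\le C\|f\|$ on it for some $C>0$. Let $\hat\rho(T)$ be the set of $\zeta\in\mathbb C$ for which $(T-\zeta I)^{-1}$ is bounded, and $\sigma(T)$ the complement of the set of $\zeta$ for which $(T-\zeta I)^{-1}$ is bounded with domain $\mathcal H$. The multiplicity of $\zeta$ for $T$ is $\dim\ker(T-\zeta I)$; $\zeta$ is an eigenvalue, $\zeta\in\sigma_p(T)$, if it is positive. The essential spectrum $\sigma_e(T)$ consists of the eigenvalues of infinite multiplicity and of the $\zeta$ for which $\operatorname{ran}(T-\zeta I)$ is not closed. $T$ is lower semi-bounded (l.s.b.)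 if for some $m\in\mathbb R$ we have $\langle f,g\rangle\ge m\|f\|^2$ (in particular $\langle f,g\rangle\in\mathbb R$) for all $(f,g)\in T$, and upper semi-bounded (u.s.b.) if $-T=\{(f,-g):(f,g)\in T\}$ is l.s.b.; $m_T$ and $M_T$ are the infimum and the supremum of $\langle f,g\rangle$ over $(f,g)\in T$ with $\|f\|=1$ (taken in the extended reals, so that $\inf\emptyset=+\infty$ and $\sup\emptyset=-\infty$). Let $A$ be a closed l.s.b. (resp. u.s.b.) relation with finite index $\eta_A=\dim N_\zeta(A^*)$, where $\zeta\in\hat\rho(A)$ (this does not depend on the choice of $\zeta$). Then for every real $\alpha<m_A$ (resp. $\alpha>M_A$) the sum $S_\alpha=A\dotplus N_\alpha(A^*)$ is direct, and: (i) $S_\alpha$ is an l.s.b. (resp. u.s.b.) selfadjoint extension of $A$, and if $\eta_A\ge1$, its greatest lower bound is $m_{S_\alpha}=\alpha$ (resp. its smallest upper bound is $M_{S_\alpha}=\alpha$). It is the only selfadjoint extension of $A$ for which $\alpha$ has multiplicity $\eta_A$; in particular it is the only such extension that also has greatest lower (resp. smallest upper) bound $\alpha$. If $\eta_A=1$, it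 is the only l.s.b. (resp. u.s.b.) selfadjoint extension of $A$ with greatest lower (resp. smallest upper) bound $\alpha$. (ii) Every point of $\sigma(S_\alpha)\cap[\alpha,m_A)$ (resp. $\sigma(S_\alpha)\cap(M_A,\alpha]$) is an eigenvalue of $S_\alpha$ of multiplicity at most $\eta_A$ and an isolated point of $\sigma(S_\alpha)$. Moreover, $\alpha$ has multiplicity $\eta_A$ for $S_\alpha$; in particular $\alpha\in\sigma_p(S_\alpha)$ if $\eta_A\ge1$. (iii) $\sigma_e(S_{\alpha_1})=\sigma_e(S_{\alpha_2})$ for all real $\alpha_1,\alpha_2<m_A$ (resp. $\alpha_1,\alpha_2>M_A$). -/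

import Mathlib

/-- A linear relation in `H`: a linear set of pairs `(f, g)` of vectors of `H`. -/
abbrev LinRel (H : Type*) [NormedAddCommGroup H] [InnerProductSpace ℂ H] : Type _ :=
  Submodule ℂ (H × H)

namespace LinRel

variable {H : Type*} [NormedAddCommGroup H] [InnerProductSpace ℂ H]

/-- The domain of `T`. -/
def dom (T : LinRel H) : Submodule ℂ H := T.map (LinearMap.fst ℂ H H)

/-- The range of `T`. -/
def ran (T : LinRel H) : Submodule ℂ H := T.map (LinearMap.snd ℂ H H)

/-- The kernel of `T`: all `f` with `(f, 0) ∈ T`. -/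
def ker (T : LinRel H) : Submodule ℂ H := T.comap (LinearMap.inl ℂ H H)

/-- The inverse relation: all `(g, f)` with `(f, g) ∈ T`. -/
def inv (T : LinRel H) : LinRel H :=
  T.map ((LinearMap.snd ℂ H H).prod (LinearMap.fst ℂ H H))

/-- The relation `-T`: all `(f, -g)` with `(f, g) ∈ T`. -/
def neg (T : LinRel H) : LinRel H :=
  T.map ((LinearMap.fst ℂ H H).prod (-LinearMap.snd ℂ H H))

/-- The relation `T - ζ I`: all `(f, g - ζ f)` with `(f, g) ∈ T`. -/
def shift (T : LinRel H) (ζ : ℂ) : LinRel H :=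
  T.map ((LinearMap.fst ℂ H H).prod (LinearMap.snd ℂ H H - ζ • LinearMap.fst ℂ H H))

/-- The adjoint relation `T*`. -/
noncomputable def adj (T : LinRel H) : LinRel H := Submodule.adjoint T

/-- `T*` consists of all `(h, k)` with `⟨k, f⟩ = ⟨h, g⟩` for every `(f, g) ∈ T`. -/
theorem mem_adj (T : LinRel H) (h k : H) :
    (h, k) ∈ adj T ↔ ∀ f g, (f, g) ∈ T → inner ℂ k f = inner ℂ h g := by
  unfold adj
  rw [Submodule.mem_adjoint_iff]
  refine forall_congr' fun f => forall_congr' fun g => imp_congr_right fun _ => ?_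
  rw [sub_eq_zero, ← inner_conj_symm g h, ← inner_conj_symm f k, eq_comm]
  exact (starRingEnd ℂ).injective.eq_iff

/-- `T` is selfadjoint: `T = T*`. -/
def SelfAdj (T : LinRel H) : Prop := T = adj T

/-- `T` is bounded: `‖g‖ ≤ C ‖f‖` on `T`, for some `C > 0`. -/
def Bdd (T : LinRel H) : Prop := ∃ C : ℝ, 0 < C ∧ ∀ p ∈ T, ‖p.2‖ ≤ C * ‖p.1‖

/-- The quasi-regular set: all `ζ` for which `(T - ζ I)⁻¹` is bounded. -/
def quasiRegular (T : LinRel H) : Set ℂ := {ζ | Bdd (inv (shift T ζ))}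

/-- The regular set: all `ζ` for which `(T - ζ I)⁻¹` is bounded and everywhere defined. -/
def regular (T : LinRel H) : Set ℂ :=
  {ζ | Bdd (inv (shift T ζ)) ∧ dom (inv (shift T ζ)) = ⊤}

/-- The spectrum `σ(T)`. -/
def spec (T : LinRel H) : Set ℂ := (regular T)ᶜ

/-- The multiplicity of `ζ` as an eigenvalue of `T`, the dimension of `ker (T - ζ I)`. -/
noncomputable def mult (T : LinRel H) (ζ : ℂ) : Cardinal := Module.rank ℂ (ker (shift T ζ))

/-- The point spectrum `σ_p(T)`. -/
def pointSpec (T : LinRel H) : Set ℂ := {ζ | ker (shift T ζ) ≠ ⊥}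

/-- The eigenvalues of infinite multiplicity, `σ_p^∞(T)`. -/
def infPointSpec (T : LinRel H) : Set ℂ :=
  {ζ | ζ ∈ pointSpec T ∧ Cardinal.aleph0 ≤ mult T ζ}

/-- The continuous spectrum `σ_c(T)`: all `ζ` for which `ran (T - ζ I)` is not closed. -/
def contSpec (T : LinRel H) : Set ℂ := {ζ | ¬ IsClosed (ran (shift T ζ) : Set H)}

/-- The essential spectrum `σ_e(T) = σ_p^∞(T) ∪ σ_c(T)`. -/
def essSpec (T : LinRel H) : Set ℂ := infPointSpec T ∪ contSpec T

/-- `ζ` is an isolated point of the spectrum of `T`. -/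
def IsolatedInSpec (T : LinRel H) (ζ : ℂ) : Prop :=
  ∃ ε : ℝ, 0 < ε ∧ Metric.ball ζ ε ∩ spec T = {ζ}

/-- The space `N_ζ(T)` of all pairs `(f, ζ f)` that belong to `T`; the deficiency space of `A`
at `ζ` is `N_ζ(A*)`. -/
def defSpace (T : LinRel H) (ζ : ℂ) : LinRel H :=
  T ⊓ LinearMap.graph (ζ • (LinearMap.id : H →ₗ[ℂ] H))

/-- `T` is lower semi-bounded: for some real `m`, the number `⟨f, g⟩` is real and at least
`m ‖f‖ ^ 2` for every `(f, g) ∈ T`. -/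
def IsLSB (T : LinRel H) : Prop :=
  ∃ m : ℝ, ∀ p ∈ T, (inner ℂ p.1 p.2).im = 0 ∧ m * ‖p.1‖ ^ 2 ≤ (inner ℂ p.1 p.2).re

/-- `T` is upper semi-bounded: `-T` is lower semi-bounded. -/
def IsUSB (T : LinRel H) : Prop := IsLSB (neg T)

/-- `m_T`, the infimum of `⟨f, g⟩` over all `(f, g) ∈ T` with `‖f‖ = 1`. It is taken in the
extended reals, so that it is `+∞` when `dom T = {0}`. -/
noncomputable def glb (T : LinRel H) : EReal :=
  sInf {x : EReal | ∃ p ∈ T, ‖p.1‖ = 1 ∧ x = ((inner ℂ p.1 p.2).re : ℝ)}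

/-- `M_T`, the supremum of `⟨f, g⟩` over all `(f, g) ∈ T` with `‖f‖ = 1`. It is taken in the
extended reals, so that it is `-∞` when `dom T = {0}`. -/
noncomputable def lub (T : LinRel H) : EReal :=
  sSup {x : EReal | ∃ p ∈ T, ‖p.1‖ = 1 ∧ x = ((inner ℂ p.1 p.2).re : ℝ)}

/-- The relation `S_α = A ∔ N_α(A*)`. -/
noncomputable def extS (A : LinRel H) (α : ℝ) : LinRel H := A ⊔ defSpace (adj A) α

end LinRel

/-!
For a symmetric relation `A`, a real quasi-regular point `α` splits the space into the closed
range `R = ran (A - α I)` and `N = Rᗮ = ker (A* - α I)`, and `S_α - α I` arises from `A - α I` by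
adding the pairs `(n, 0)` with `n ∈ N`. Nearly everything is read off from this.

* If `(h, k) ∈ S_α*`, then `k - α h` is orthogonal to `N`, so it lies in `R`; this makes `S_α`
  selfadjoint (`LinRel.selfAdj_extS`). As `n ⟂ R`, the form of `S_α - α I` is that of `A - α I`
  and vanishes on `N`, so `α` is the optimal bound of `S_α` once `N ≠ 0`.
* The index `dim (ran (A - ζ I))ᗮ` does not depend on the quasi-regular point `ζ`: it is locally
  constant because orthogonal projection embeds neighboring deficiency spaces into each other, and
  every non-real point is joined to `α` by a segment of quasi-regular points
  (`LinRel.rank_orthogonal_ran_eq`).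
* A selfadjoint extension `T` of `A` satisfies `ker (T - α I) ⊆ N`, with equality if the (finite)
  dimensions agree, and then `S_α ⊆ T` forces `T = S_α`. For index one and `T` with optimal bound
  `α`, the number `α` is an eigenvalue of `T`: otherwise it would be regular, and a semi-bounded
  form `T - α I` with bounded inverse has a better bound (`LinRel.SelfAdj.exists_formBound`).
* At a real quasi-regular point `x` of `A` the range of `T - x I` contains a closed space of finite
  codimension, so it is closed. Then `x` is an eigenvalue or regular. As `T - x I` has a
  bounded inverse on the complement of its kernel, a punctured neighborhood of `x` is regular
  (`LinRel.SelfAdj.isolatedInSpec`).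
* Extending `A` by a finite-dimensional space changes neither which of the ranges are closed nor
  which of the kernels are infinite-dimensional, so `S_α` has the essential spectrum of `A`
  (`LinRel.essSpec_extS`).

Lower and upper bounds are treated together, through the inequality `s (T - α I) ≥ c` with
`s = 1` or `s = -1` (`LinRel.FormBound`).
-/

namespace LinRel

variable {H : Type*} [NormedAddCommGroup H] [InnerProductSpace ℂ H]

/-! ### Relations, their ranges and their kernels -/

/-- The continuous map `(f, g) ↦ g - ζ f`, which sends a relation `T` onto `ran (T - ζ I)`. -/
noncomputable def evalShift (ζ : ℂ) : H × H →L[ℂ] H :=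
  ContinuousLinearMap.snd ℂ H H - ζ • ContinuousLinearMap.fst ℂ H H

@[simp]
theorem evalShift_apply (ζ : ℂ) (p : H × H) : evalShift ζ p = p.2 - ζ • p.1 := rfl

theorem mem_shift {T : LinRel H} {ζ : ℂ} {f g : H} :
    (f, g) ∈ shift T ζ ↔ (f, g + ζ • f) ∈ T := by
  constructor
  · rintro ⟨⟨a, b⟩, hab, ⟨⟩⟩
    simpa using hab
  · intro h
    exact ⟨_, h, by simp⟩

theorem mem_inv {T : LinRel H} {f g : H} : (f, g) ∈ inv T ↔ (g, f) ∈ T := by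
  constructor
  · rintro ⟨⟨a, b⟩, hab, ⟨⟩⟩
    exact hab
  · intro h
    exact ⟨_, h, by simp⟩

theorem mem_neg {T : LinRel H} {f g : H} : (f, g) ∈ neg T ↔ (f, -g) ∈ T := by
  constructor
  · rintro ⟨⟨a, b⟩, hab, ⟨⟩⟩
    simpa using hab
  · intro h
    exact ⟨_, h, by simp⟩

theorem mem_ker_shift {T : LinRel H} {ζ : ℂ} {f : H} :
    f ∈ ker (shift T ζ) ↔ (f, ζ • f) ∈ T := by
  change (f, (0 : H)) ∈ shift T ζ ↔ _
  rw [mem_shift, zero_add]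

theorem mem_defSpace {T : LinRel H} {ζ : ℂ} {f g : H} :
    (f, g) ∈ defSpace T ζ ↔ (f, g) ∈ T ∧ g = ζ • f := by
  simp [defSpace, Submodule.mem_inf, LinearMap.mem_graph_iff]

theorem ran_shift_eq_map (T : LinRel H) (ζ : ℂ) :
    ran (shift T ζ) = T.map (evalShift (H := H) ζ).toLinearMap := by
  rw [ran, shift, ← Submodule.map_comp]
  rfl

theorem mem_ran_shift {T : LinRel H} {ζ : ℂ} {y : H} :
    y ∈ ran (shift T ζ) ↔ ∃ f g, (f, g) ∈ T ∧ g - ζ • f = y := by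
  rw [ran_shift_eq_map]
  simp [Submodule.mem_map]

theorem range_evalShift_comp_subtypeL (T : LinRel H) (ζ : ℂ) :
    Set.range ((evalShift ζ).comp T.subtypeL) = (ran (shift T ζ) : Set H) := by
  ext y
  rw [SetLike.mem_coe, mem_ran_shift]
  constructor
  · rintro ⟨⟨⟨f, g⟩, hfg⟩, rfl⟩
    exact ⟨f, g, hfg, rfl⟩
  · rintro ⟨f, g, hfg, rfl⟩
    exact ⟨⟨(f, g), hfg⟩, rfl⟩

theorem dom_inv (T : LinRel H) : dom (inv T) = ran T := by
  rw [dom, inv, ← Submodule.map_comp]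
  rfl

theorem mem_quasiRegular {T : LinRel H} {ζ : ℂ} :
    ζ ∈ quasiRegular T ↔ ∃ C : ℝ, 0 < C ∧ ∀ f g, (f, g) ∈ T → ‖f‖ ≤ C * ‖g - ζ • f‖ := by
  refine exists_congr fun C => and_congr_right fun _ => ?_
  constructor
  · intro h f g hfg
    exact h (g - ζ • f, f) (mem_inv.2 (mem_shift.2 (by simpa using hfg)))
  · rintro h ⟨g, f⟩ hp
    simpa using h _ _ (mem_shift.1 (mem_inv.1 hp))

theorem mem_regular {T : LinRel H} {ζ : ℂ} :
    ζ ∈ regular T ↔ ζ ∈ quasiRegular T ∧ ran (shift T ζ) = ⊤ := by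
  rw [← dom_inv]
  rfl

theorem mult_eq_rank_defSpace (T : LinRel H) (ζ : ℂ) :
    mult T ζ = Module.rank ℂ (defSpace T ζ) := by
  have h : defSpace T ζ =
      (ker (shift T ζ)).map (LinearMap.prod LinearMap.id (ζ • LinearMap.id)) := by
    ext ⟨f, g⟩
    rw [mem_defSpace, Submodule.mem_map]
    constructor
    · rintro ⟨hfg, rfl⟩
      exact ⟨f, mem_ker_shift.2 hfg, rfl⟩
    · rintro ⟨a, ha, ⟨⟩⟩
      exact ⟨mem_ker_shift.1 ha, rfl⟩
  rw [h, mult]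
  refine (Submodule.equivMapOfInjective _ ?_ _).rank_eq
  intro a b hab
  exact congrArg Prod.fst hab

theorem mult_mono {S T : LinRel H} (h : S ≤ T) (ζ : ℂ) : mult S ζ ≤ mult T ζ :=
  Submodule.rank_mono fun _ hf => mem_ker_shift.2 (h (mem_ker_shift.1 hf))

theorem pointSpec_of_mult_ne_zero {T : LinRel H} {ζ : ℂ} (h : mult T ζ ≠ 0) :
    ζ ∈ pointSpec T := by
  intro h0
  apply h
  rw [mult, h0, rank_bot]

/-- `ker (T* - ζ I)` is the orthogonal complement of `ran (T - ζ̄ I)`. -/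
theorem ker_shift_adj (T : LinRel H) (ζ : ℂ) :
    ker (shift (adj T) ζ) = (ran (shift T (starRingEnd ℂ ζ)))ᗮ := by
  ext h
  rw [mem_ker_shift, mem_adj, Submodule.mem_orthogonal']
  constructor
  · intro H u hu
    obtain ⟨f, g, hfg, rfl⟩ := mem_ran_shift.1 hu
    have := H f g hfg
    rw [inner_smul_left] at this
    rw [inner_sub_right, inner_smul_right, this, sub_self]
  · intro H f g hfg
    have := H _ (mem_ran_shift.2 ⟨f, g, hfg, rfl⟩)
    rw [inner_sub_right, inner_smul_right, sub_eq_zero] at this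
    rw [inner_smul_left, this]

/-- For selfadjoint `T`, the kernel of `T - ζ I` is the orthogonal complement of
`ran (T - ζ̄ I)`. -/
theorem SelfAdj.ker_shift {T : LinRel H} (hT : SelfAdj T) (ζ : ℂ) :
    ker (shift T ζ) = (ran (shift T (starRingEnd ℂ ζ)))ᗮ := by
  rw [← ker_shift_adj, ← hT]

theorem adj_anti {S T : LinRel H} (h : S ≤ T) : adj T ≤ adj S := by
  rintro ⟨a, b⟩ hab
  exact (mem_adj _ _ _).2 fun f g hfg => (mem_adj _ _ _).1 hab f g (h hfg)

theorem isClosed_adj (T : LinRel H) : IsClosed (adj T : Set (H × H)) := by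
  have : (adj T : Set (H × H)) =
      ⋂ q ∈ T, {p : H × H | inner ℂ p.2 q.1 = inner ℂ p.1 q.2} := by
    ext ⟨h, k⟩
    simp only [SetLike.mem_coe, mem_adj, Set.mem_iInter, Set.mem_ofPred_eq, Prod.forall]
  rw [this]
  refine isClosed_biInter fun q _ => isClosed_eq ?_ ?_ <;> fun_prop

theorem SelfAdj.isClosed {T : LinRel H} (hT : SelfAdj T) : IsClosed (T : Set (H × H)) := by
  rw [hT]
  exact isClosed_adj T

/-- A relation whose form `⟨f, g⟩` is real is contained in its adjoint, by polarization. -/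
theorem le_adj_of_im_eq_zero {T : LinRel H} (hT : ∀ p ∈ T, (inner ℂ p.1 p.2).im = 0) :
    T ≤ adj T := by
  rintro ⟨h, k⟩ hhk
  rw [mem_adj]
  intro f g hfg
  have h1 := hT _ hhk
  have h2 := hT _ hfg
  have h3 := hT _ (T.add_mem hhk hfg)
  have h4 := hT _ (T.add_mem hhk (T.smul_mem Complex.I hfg))
  simp only [Prod.fst_add, Prod.snd_add, Prod.smul_fst, Prod.smul_snd, inner_add_left,
    inner_add_right, inner_smul_left, inner_smul_right, Complex.add_im, Complex.mul_im,
    Complex.conj_I, Complex.add_re, Complex.I_re, Complex.I_im, Complex.neg_re, Complex.neg_im,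
    Complex.mul_re] at h1 h2 h3 h4
  rw [← inner_conj_symm k f]
  apply Complex.ext
  · rw [Complex.conj_re]
    linarith
  · rw [Complex.conj_im]
    linarith

/-- The form `⟨f, g⟩` of a symmetric relation is real. -/
theorem im_eq_zero_of_le_adj {T : LinRel H} (hT : T ≤ adj T) {p : H × H} (hp : p ∈ T) :
    (inner ℂ p.1 p.2).im = 0 := by
  have := (mem_adj T p.1 p.2).1 (hT hp) p.1 p.2 hp
  rw [← inner_conj_symm] at this
  exact Complex.conj_eq_iff_im.1 this

theorem SelfAdj.le_adj {T : LinRel H} (hT : SelfAdj T) : T ≤ adj T := le_of_eq hT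

/-! ### The quasi-regular set -/

/-- If `ζ` is quasi-regular for a closed relation, then `ran (T - ζ I)` is closed. -/
theorem isClosed_ran_shift [CompleteSpace H] {T : LinRel H} (hT : IsClosed (T : Set (H × H)))
    {ζ : ℂ} (hζ : ζ ∈ quasiRegular T) : IsClosed (ran (shift T ζ) : Set H) := by
  obtain ⟨C, hC, h⟩ := mem_quasiRegular.1 hζ
  have : CompleteSpace T := hT.completeSpace_coe
  -- On `T`, both components of `(f, g)` are controlled by `g - ζ f`.
  have key : AntilipschitzWith (C + (1 + ‖ζ‖ * C)).toNNReal
      ((evalShift ζ).comp T.subtypeL) := by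
    refine ContinuousLinearMap.antilipschitz_of_bound _ ?_
    rintro ⟨⟨f, g⟩, hfg⟩
    have h1 := h f g hfg
    rw [Real.coe_toNNReal _ (by positivity)]
    change ‖(f, g)‖ ≤ _ * ‖g - ζ • f‖
    have h2 : ‖g‖ ≤ ‖g - ζ • f‖ + ‖ζ‖ * ‖f‖ := by
      rw [← norm_smul]
      simpa using norm_add_le (g - ζ • f) (ζ • f)
    have h3 : ‖ζ‖ * ‖f‖ ≤ ‖ζ‖ * (C * ‖g - ζ • f‖) := by gcongr
    have h4 : 0 ≤ C * ‖g - ζ • f‖ := by positivity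
    have h5 : 0 ≤ ‖ζ‖ * (C * ‖g - ζ • f‖) := by positivity
    have h6 := norm_nonneg (g - ζ • f)
    rw [Prod.norm_def]
    refine max_le ?_ ?_ <;> simp only <;> linarith
  have := key.isClosed_range ((evalShift ζ).comp T.subtypeL).uniformContinuous
  rwa [range_evalShift_comp_subtypeL] at this

/-- Every non-real number is quasi-regular for a symmetric relation. -/
theorem mem_quasiRegular_of_im_ne_zero {T : LinRel H} (hT : T ≤ adj T) {ζ : ℂ}
    (hζ : ζ.im ≠ 0) : ζ ∈ quasiRegular T := by
  have hpos : 0 < |ζ.im| := abs_pos.2 hζ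
  refine mem_quasiRegular.2 ⟨|ζ.im|⁻¹, by positivity, fun f g hfg => ?_⟩
  have h0 := im_eq_zero_of_le_adj hT hfg
  have h1 : (inner ℂ f (g - ζ • f)).im = -(ζ.im * ‖f‖ ^ 2) := by
    rw [inner_sub_right, inner_smul_right, inner_self_eq_norm_sq_to_K, Complex.sub_im, h0,
      zero_sub]
    exact congrArg Neg.neg (by rw [← Complex.im_mul_ofReal, Complex.ofReal_pow]; rfl)
  have h2 : |ζ.im| * ‖f‖ ^ 2 ≤ ‖f‖ * ‖g - ζ • f‖ := by
    have := (Complex.abs_im_le_norm _).trans (norm_inner_le_norm (𝕜 := ℂ) f (g - ζ • f))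
    rwa [h1, abs_neg, abs_mul, abs_of_nonneg (sq_nonneg ‖f‖)] at this
  rw [inv_mul_eq_div, le_div_iff₀ hpos]
  rcases (norm_nonneg f).eq_or_lt with h | h
  · rw [← h, zero_mul]
    exact norm_nonneg _
  · refine le_of_mul_le_mul_left ?_ h
    linarith [h2]

/-- Two numbers whose distance is small against the bound at one of them: orthogonal projection
embeds the deficiency space at `w` into the one at `ζ`, as a vector of the former which lies in
`ran (T - ζ I)` must vanish. -/
theorem rank_orthogonal_ran_le [CompleteSpace H] {T : LinRel H}
    (hT : IsClosed (T : Set (H × H))) {ζ w : ℂ} {C : ℝ} (hC : 0 < C)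
    (hζ : ∀ f g, (f, g) ∈ T → ‖f‖ ≤ C * ‖g - ζ • f‖) (hw : ‖w - ζ‖ * C < 1) :
    Module.rank ℂ (ran (shift T w))ᗮ ≤ Module.rank ℂ (ran (shift T ζ))ᗮ := by
  have hcl : IsClosed (ran (shift T ζ) : Set H) :=
    isClosed_ran_shift hT (mem_quasiRegular.2 ⟨C, hC, hζ⟩)
  have : CompleteSpace (ran (shift T ζ)) := hcl.completeSpace_coe
  let P : (ran (shift T w))ᗮ →ₗ[ℂ] (ran (shift T ζ))ᗮ :=
    ((ran (shift T ζ))ᗮ.orthogonalProjectionOnto : H →ₗ[ℂ] (ran (shift T ζ))ᗮ).domRestrict _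
  refine LinearMap.rank_le_of_injective P ((injective_iff_map_eq_zero P).2 ?_)
  rintro ⟨u, hu⟩ hPu
  have hu' : u ∈ ran (shift T ζ) := by
    have h1 : (ran (shift T ζ))ᗮ.orthogonalProjectionOnto u = 0 := hPu
    rwa [Submodule.orthogonalProjectionOnto_eq_zero_iff, Submodule.orthogonal_orthogonal] at h1
  obtain ⟨f, g, hfg, rfl⟩ := mem_ran_shift.1 hu'
  have h1 := (Submodule.mem_orthogonal' _ _).1 hu _ (mem_ran_shift.2 ⟨f, g, hfg, rfl⟩)
  have h2 := hζ f g hfg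
  set u := g - ζ • f with hu_def
  have h3 : g - w • f = u - (w - ζ) • f := by
    rw [hu_def]
    module
  rw [h3, inner_sub_right, sub_eq_zero, inner_smul_right, inner_self_eq_norm_sq_to_K] at h1
  have h4 : ‖u‖ ^ 2 ≤ ‖w - ζ‖ * C * ‖u‖ ^ 2 := by
    calc ‖u‖ ^ 2 = ‖((‖u‖ : ℂ)) ^ 2‖ := by simp
      _ = ‖w - ζ‖ * ‖inner ℂ u f‖ := by
        rw [← norm_mul]
        exact congrArg _ h1
      _ ≤ ‖w - ζ‖ * (‖u‖ * (C * ‖u‖)) := by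
        gcongr
        exact (norm_inner_le_norm u f).trans (by gcongr)
      _ = ‖w - ζ‖ * C * ‖u‖ ^ 2 := by ring
  have h5 : u = 0 := by
    by_contra hne
    have : 0 < ‖u‖ ^ 2 := by positivity
    nlinarith
  exact Subtype.ext h5

/-- The index `dim (ran (T - ζ I))ᗮ` is locally constant on the quasi-regular set. -/
theorem eventually_rank_orthogonal_ran_eq [CompleteSpace H] {T : LinRel H}
    (hT : IsClosed (T : Set (H × H))) {ζ : ℂ} (hζ : ζ ∈ quasiRegular T) :
    ∀ᶠ w in nhds ζ,
      Module.rank ℂ (ran (shift T w))ᗮ = Module.rank ℂ (ran (shift T ζ))ᗮ := by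
  obtain ⟨C, hC, h⟩ := mem_quasiRegular.1 hζ
  -- Within distance `1 / (3 C)` of `ζ`, the bound `C` deteriorates to `2 C` at most.
  filter_upwards [Metric.ball_mem_nhds ζ (show 0 < 1 / (3 * C) by positivity)] with w hw
  rw [Metric.mem_ball, dist_eq_norm, lt_div_iff₀ (by positivity)] at hw
  refine le_antisymm (rank_orthogonal_ran_le hT hC h ?_)
    (rank_orthogonal_ran_le hT (C := 2 * C) (by positivity) (fun f g hfg => ?_) ?_)
  · linarith [norm_nonneg (w - ζ)]
  · have h1 := h f g hfg
    have h2 : ‖g - ζ • f‖ ≤ ‖g - w • f‖ + ‖w - ζ‖ * ‖f‖ := by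
      rw [← norm_smul]
      refine le_trans (le_of_eq ?_) (norm_add_le _ _)
      congr 1
      module
    have h3 : C * ‖g - ζ • f‖ ≤ C * (‖g - w • f‖ + ‖w - ζ‖ * ‖f‖) := by gcongr
    nlinarith [norm_nonneg f]
  · rw [norm_sub_rev]
    linarith [norm_nonneg (w - ζ)]

/-- If a real number is quasi-regular for a closed symmetric relation, then the index is the same
at all quasi-regular points: a non-real point is joined to the real one by a segment, and a
second real one has non-real points nearby. -/
theorem rank_orthogonal_ran_eq [CompleteSpace H] {T : LinRel H}
    (hT : IsClosed (T : Set (H × H))) (hsymm : T ≤ adj T) {α : ℝ}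
    (hα : (α : ℂ) ∈ quasiRegular T) {ζ : ℂ} (hζ : ζ ∈ quasiRegular T) :
    Module.rank ℂ (ran (shift T ζ))ᗮ = Module.rank ℂ (ran (shift T α))ᗮ := by
  have nonreal : ∀ w : ℂ, w.im ≠ 0 →
      Module.rank ℂ (ran (shift T w))ᗮ = Module.rank ℂ (ran (shift T α))ᗮ := by
    intro w hw
    refine (convex_segment (𝕜 := ℝ) w (α : ℂ)).isPreconnected.induction₂'
      (fun x y => Module.rank ℂ (ran (shift T x))ᗮ = Module.rank ℂ (ran (shift T y))ᗮ)
      (fun x hx => ?_) (fun _ _ _ _ _ _ => Eq.trans) (left_mem_segment ..)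
      (right_mem_segment ..)
    have hx' : x ∈ quasiRegular T := by
      obtain ⟨a, b, ha, hb, hab, rfl⟩ := hx
      rcases ha.eq_or_lt with rfl | ha
      · obtain rfl : b = 1 := by linarith
        simpa using hα
      · refine mem_quasiRegular_of_im_ne_zero hsymm ?_
        simp [ha.ne', hw]
    filter_upwards [nhdsWithin_le_nhds (eventually_rank_orthogonal_ran_eq hT hx')] with y hy
    exact ⟨hy.symm, hy⟩
  by_cases him : ζ.im = 0
  · obtain ⟨ε, hε, hball⟩ := Metric.eventually_nhds_iff_ball.1
      (eventually_rank_orthogonal_ran_eq hT hζ)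
    have hmem : ζ + ((ε / 2 : ℝ) : ℂ) * Complex.I ∈ Metric.ball ζ ε := by
      rw [Metric.mem_ball, dist_eq_norm, add_sub_cancel_left, norm_mul, Complex.norm_I, mul_one,
        Complex.norm_real, Real.norm_of_nonneg (by positivity)]
      linarith
    rw [← hball _ hmem]
    refine nonreal _ ?_
    simp [him, hε.ne']
  · exact nonreal ζ him

/-! ### Selfadjoint relations with closed `ran (T - ζ I)` -/

/-- If `ran (T - ζ I)` is closed and `ζ` is not an eigenvalue of the closed relation `T`, then
`(T - ζ I)⁻¹` is bounded, by the open mapping theorem. -/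
theorem mem_quasiRegular_of_isClosed_ran [CompleteSpace H] {T : LinRel H}
    (hT : IsClosed (T : Set (H × H))) {ζ : ℂ} (hran : IsClosed (ran (shift T ζ) : Set H))
    (hker : ker (shift T ζ) = ⊥) : ζ ∈ quasiRegular T := by
  have : CompleteSpace T := hT.completeSpace_coe
  have hinj : Function.Injective ((evalShift ζ).comp T.subtypeL) := by
    refine (injective_iff_map_eq_zero _).2 ?_
    rintro ⟨⟨f, g⟩, hfg⟩ h
    obtain rfl : g = ζ • f := sub_eq_zero.1 h
    obtain rfl : f = 0 := by
      rw [← Submodule.mem_bot ℂ, ← hker]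
      exact mem_ker_shift.2 hfg
    exact Subtype.ext (by simp)
  obtain ⟨K, hK⟩ := ContinuousLinearMap.antilipschitz_of_injective_of_isClosed_range
    ((evalShift ζ).comp T.subtypeL) hinj (by
      rwa [range_evalShift_comp_subtypeL])
  refine mem_quasiRegular.2 ⟨K + 1, by positivity, fun f g hfg => ?_⟩
  have h1 := hK.le_mul_dist ⟨(f, g), hfg⟩ 0
  rw [map_zero, dist_zero_right, dist_zero_right] at h1
  have h2 : ‖(f, g)‖ ≤ K * ‖g - ζ • f‖ := h1
  have h3 := norm_fst_le (f, g)
  have h4 := norm_nonneg (g - ζ • f)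
  simp only at h3
  linarith

/-- For selfadjoint `T`, a closed range of `T - ζ I` is the whole space as soon as `ζ̄` is not an
eigenvalue. -/
theorem SelfAdj.ran_shift_eq_top [CompleteSpace H] {T : LinRel H} (hT : SelfAdj T) {ζ : ℂ}
    (hran : IsClosed (ran (shift T ζ) : Set H))
    (hker : ker (shift T (starRingEnd ℂ ζ)) = ⊥) : ran (shift T ζ) = ⊤ := by
  have : CompleteSpace (ran (shift T ζ)) := hran.completeSpace_coe
  rw [hT.ker_shift, Complex.conj_conj] at hker
  exact (Submodule.orthogonal_eq_bot_iff).1 hker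

/-- A real number which is not an eigenvalue of the selfadjoint `T` is regular if
`ran (T - x I)` is closed. -/
theorem SelfAdj.mem_regular_of_isClosed_ran [CompleteSpace H] {T : LinRel H} (hT : SelfAdj T)
    {x : ℝ} (hran : IsClosed (ran (shift T x) : Set H)) (hx : (x : ℂ) ∉ pointSpec T) :
    (x : ℂ) ∈ regular T := by
  have hker : ker (shift T x) = ⊥ := not_not.1 hx
  exact mem_regular.2 ⟨mem_quasiRegular_of_isClosed_ran hT.isClosed hran hker,
    hT.ran_shift_eq_top hran (by rwa [Complex.conj_ofReal])⟩

theorem ker_shift_eq_bot_of_mem_quasiRegular {T : LinRel H} {ζ : ℂ}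
    (hζ : ζ ∈ quasiRegular T) : ker (shift T ζ) = ⊥ := by
  obtain ⟨C, -, h⟩ := mem_quasiRegular.1 hζ
  refine (Submodule.eq_bot_iff _).2 fun f hf => ?_
  simpa using h _ _ (mem_ker_shift.1 hf)

/-- Let `ran (T - x I)` be closed, for a selfadjoint `T` and a real `x`. The part of `T - x I` in
the orthogonal complement of its kernel has a bounded inverse, so that all points of a punctured
neighborhood of `x` are quasi-regular. -/
theorem SelfAdj.exists_ball_subset_quasiRegular [CompleteSpace H] {T : LinRel H}
    (hT : SelfAdj T) {x : ℝ} (hran : IsClosed (ran (shift T x) : Set H)) :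
    ∃ ε : ℝ, 0 < ε ∧ ∀ w : ℂ, ‖w - x‖ < ε → w ≠ x → w ∈ quasiRegular T := by
  set K := ker (shift T (x : ℂ)) with hK_def
  have hK : K = (ran (shift T (x : ℂ)))ᗮ := by
    rw [hK_def, hT.ker_shift, Complex.conj_ofReal]
  have : CompleteSpace K := by
    rw [hK]
    infer_instance
  -- The part `T'` of `T` with domain in the complement of `K`.
  let T' : LinRel H := T ⊓ Kᗮ.comap (LinearMap.fst ℂ H H)
  have hT' : IsClosed (T' : Set (H × H)) :=
    hT.isClosed.inter ((Submodule.isClosed_orthogonal K).preimage continuous_fst)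
  have split : ∀ f g, (f, g) ∈ T → ∃ k f', k ∈ K ∧ f' ∈ Kᗮ ∧ f = f' + k ∧
      (f', g - (x : ℂ) • k) ∈ T' := by
    intro f g hfg
    obtain ⟨k, hk, f', hf', rfl⟩ := K.exists_add_mem_mem_orthogonal f
    refine ⟨k, f', hk, hf', add_comm _ _, ?_, hf'⟩
    have := T.sub_mem hfg (mem_ker_shift.1 hk)
    simpa using this
  have hran' : ran (shift T' x) = ran (shift T x) := by
    ext y
    rw [mem_ran_shift, mem_ran_shift]
    constructor
    · rintro ⟨f, g, hfg, h⟩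
      exact ⟨f, g, hfg.1, h⟩
    · rintro ⟨f, g, hfg, rfl⟩
      obtain ⟨k, f', -, -, rfl, h⟩ := split f g hfg
      exact ⟨_, _, h, by module⟩
  have hker' : ker (shift T' x) = ⊥ := by
    refine (Submodule.eq_bot_iff _).2 fun f hf => ?_
    have h := mem_ker_shift.1 hf
    have h1 : f ∈ K := mem_ker_shift.2 h.1
    exact inner_self_eq_zero.1 ((Submodule.mem_orthogonal _ _).1 h.2 f h1)
  obtain ⟨C, hC, hbd⟩ := mem_quasiRegular.1
    (mem_quasiRegular_of_isClosed_ran hT' (by rwa [hran']) hker')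
  refine ⟨1 / (2 * C), by positivity, fun w hw hne => ?_⟩
  rw [lt_div_iff₀ (by positivity)] at hw
  have hpos : 0 < ‖w - x‖ := norm_pos_iff.2 (sub_ne_zero.2 hne)
  refine mem_quasiRegular.2 ⟨2 * C + 1 / ‖w - x‖, by positivity, fun f g hfg => ?_⟩
  obtain ⟨k, f', hk, hf', rfl, h⟩ := split f g hfg
  have hb := hbd _ _ h
  set u := g - (x : ℂ) • k - (x : ℂ) • f' with hu
  have hu_ran : u ∈ ran (shift T x) := mem_ran_shift.2 ⟨f', _, h.1, rfl⟩
  -- `g - w f` splits into a part in the complement of `K` and the part `-(w - x) k` in `K`.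
  have hdec : g - w • (f' + k) = (u - (w - x) • f') + (-(w - x)) • k := by
    rw [hu]
    module
  have horth : inner ℂ (u - (w - x) • f') ((-(w - x)) • k) = 0 := by
    have h1 : inner ℂ u k = 0 := by
      rw [hK] at hk
      exact (Submodule.mem_orthogonal _ _).1 hk _ hu_ran
    have h2 : inner ℂ f' k = 0 := (Submodule.mem_orthogonal' _ _).1 hf' _ hk
    rw [inner_smul_right, inner_sub_left, inner_smul_left, h1, h2]
    simp
  have hpyth := norm_add_sq_eq_norm_sq_add_norm_sq_of_inner_eq_zero _ _ horth
  rw [← hdec] at hpyth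
  set y := g - w • (f' + k)
  have h1 : ‖u - (w - x) • f'‖ ≤ ‖y‖ :=
    abs_le_of_sq_le_sq' (by nlinarith [sq_nonneg ‖(-(w - x)) • k‖]) (norm_nonneg y) |>.2
  have h2 : ‖(-(w - x)) • k‖ ≤ ‖y‖ :=
    abs_le_of_sq_le_sq' (by nlinarith [sq_nonneg ‖u - (w - x) • f'‖]) (norm_nonneg y) |>.2
  rw [norm_smul, norm_neg] at h2
  have h3 : ‖u‖ ≤ ‖y‖ + ‖w - x‖ * ‖f'‖ := by
    have := norm_add_le (u - (w - x) • f') ((w - (x : ℂ)) • f')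
    rw [sub_add_cancel, norm_smul] at this
    linarith
  have h4 : ‖f'‖ ≤ 2 * C * ‖y‖ := by
    have : C * ‖u‖ ≤ C * (‖y‖ + ‖w - x‖ * ‖f'‖) := by gcongr
    nlinarith [norm_nonneg f']
  have h5 : ‖k‖ ≤ 1 / ‖w - x‖ * ‖y‖ := by
    rw [one_div, inv_mul_eq_div, le_div_iff₀ hpos]
    linarith
  calc ‖f' + k‖ ≤ ‖f'‖ + ‖k‖ := norm_add_le _ _
    _ ≤ (2 * C + 1 / ‖w - x‖) * ‖y‖ := by linarith

/-- A real point of the spectrum of a selfadjoint `T` for which `ran (T - x I)` is closed is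
isolated. -/
theorem SelfAdj.isolatedInSpec [CompleteSpace H] {T : LinRel H} (hT : SelfAdj T) {x : ℝ}
    (hran : IsClosed (ran (shift T x) : Set H)) (hx : (x : ℂ) ∈ spec T) :
    IsolatedInSpec T x := by
  obtain ⟨ε, hε, h⟩ := hT.exists_ball_subset_quasiRegular hran
  refine ⟨ε, hε, Set.Subset.antisymm ?_ ?_⟩
  · rintro w ⟨hw, hspec⟩
    rw [Metric.mem_ball, dist_eq_norm] at hw
    by_contra hne
    have h1 := h w hw hne
    have h2 : starRingEnd ℂ w ∈ quasiRegular T := by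
      refine h _ ?_ fun h' => hne ?_
      · rwa [← Complex.conj_ofReal x, ← map_sub, Complex.norm_conj]
      · rw [Set.mem_singleton_iff, ← Complex.conj_conj w, h', Complex.conj_ofReal]
    exact hspec (mem_regular.2 ⟨h1, hT.ran_shift_eq_top (isClosed_ran_shift hT.isClosed h1)
      (ker_shift_eq_bot_of_mem_quasiRegular h2)⟩)
  · rintro _ rfl
    exact ⟨Metric.mem_ball_self hε, hx⟩

/-- If `ran (A - ζ I)` is closed and has a finite-dimensional orthogonal complement, then
`ran (T - ζ I)` is closed for every extension `T` of `A`. -/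
theorem isClosed_ran_shift_of_le [CompleteSpace H] {A T : LinRel H} (hAT : A ≤ T) {ζ : ℂ}
    (hran : IsClosed (ran (shift A ζ) : Set H))
    (hfin : Module.rank ℂ (ran (shift A ζ))ᗮ < Cardinal.aleph0) :
    IsClosed (ran (shift T ζ) : Set H) := by
  have : CompleteSpace (ran (shift A ζ)) := hran.completeSpace_coe
  have : FiniteDimensional ℂ (ran (shift A ζ))ᗮ := Module.rank_lt_aleph0_iff.1 hfin
  have : FiniteDimensional ℂ (H ⧸ ran (shift A ζ)) :=
    (Submodule.quotientEquivOfIsCompl _ _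
      (Submodule.isCompl_orthogonal
        (K := ran (shift A ζ)))).symm.finiteDimensional
  refine Submodule.isClosed_mono_of_finiteDimensional_quotient hran ?_
  rw [ran_shift_eq_map, ran_shift_eq_map]
  exact Submodule.map_mono hAT

/-! ### Essential spectra of finite-dimensional extensions -/

/-- A bounded operator with closed range maps closed subspaces of finite codimension to closed
subspaces. -/
theorem isClosed_map_of_isClosed_range {E F : Type*} [NormedAddCommGroup E] [NormedSpace ℂ E]
    [CompleteSpace E] [NormedAddCommGroup F] [NormedSpace ℂ F] [CompleteSpace F] (ψ : E →L[ℂ] F)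
    (hψ : IsClosed (Set.range ψ)) (B : Submodule ℂ E) (hB : IsClosed (B : Set E))
    [FiniteDimensional ℂ (E ⧸ B)] : IsClosed (ψ '' B) := by
  have : CompleteSpace ψ.range := IsClosed.completeSpace_coe (hs := hψ)
  have hsurj : Function.Surjective ψ.rangeRestrict := ψ.toLinearMap.surjective_rangeRestrict
  have hquot := (ψ.rangeRestrict.isOpenMap hsurj).isQuotientMap ψ.rangeRestrict.continuous hsurj
  -- The preimage of the image is `B + ker ψ`, which is closed because it contains `B`.
  have hpre : IsClosed ((B ⊔ ψ.ker : Submodule ℂ E) : Set E) :=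
    Submodule.isClosed_mono_of_finiteDimensional_quotient hB le_sup_left
  have hset : ψ.rangeRestrict ⁻¹' (ψ.rangeRestrict '' B) =
      ((B ⊔ ψ.ker : Submodule ℂ E) : Set E) := by
    ext e
    simp only [Set.mem_preimage, Set.mem_image, SetLike.mem_coe, Submodule.mem_sup]
    constructor
    · rintro ⟨b, hb, h⟩
      have h' : ψ b = ψ e := congrArg Subtype.val h
      exact ⟨b, hb, e - b, by simp [h'], by simp⟩
    · rintro ⟨b, hb, k, hk, rfl⟩
      refine ⟨b, hb, Subtype.ext ?_⟩
      have hk' : ψ k = 0 := hk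
      simp [hk']
  have hcl : IsClosed (ψ.rangeRestrict '' B) := by
    rw [← hquot.isClosed_preimage, hset]
    exact hpre
  have := (IsClosed.isClosedEmbedding_subtypeVal
    (s := (ψ.range : Set F)) hψ).isClosedMap _ hcl
  rwa [Set.image_image] at this

/-- The quotient of `A + F` by `A` is finite-dimensional if `F` is. -/
theorem finiteDimensional_quotient_sup {E : Type*} [AddCommGroup E] [Module ℂ E]
    (A F : Submodule ℂ E) [FiniteDimensional ℂ F] :
    FiniteDimensional ℂ (↥(A ⊔ F) ⧸ A.comap (A ⊔ F).subtype) := by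
  have e := LinearMap.quotientInfEquivSupQuotient F A
  rw [sup_comm] at e
  exact e.finiteDimensional

/-- A closed extension of the closed `A` by a finite-dimensional space has the same continuous
spectrum as `A`. -/
theorem contSpec_sup [CompleteSpace H] {A F : LinRel H} [FiniteDimensional ℂ F]
    (hA : IsClosed (A : Set (H × H))) (hS : IsClosed ((A ⊔ F : LinRel H) : Set (H × H))) :
    contSpec (A ⊔ F) = contSpec A := by
  ext ζ
  refine not_congr ⟨fun h => ?_, fun h => ?_⟩
  · have : CompleteSpace ↥(A ⊔ F) := hS.completeSpace_coe
    have := finiteDimensional_quotient_sup A F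
    have := isClosed_map_of_isClosed_range ((evalShift ζ).comp (A ⊔ F).subtypeL) (by
      rwa [range_evalShift_comp_subtypeL])
      (A.comap (A ⊔ F).subtype) (hA.preimage continuous_subtype_val)
    convert this using 1
    ext y
    rw [SetLike.mem_coe, mem_ran_shift]
    constructor
    · rintro ⟨f, g, hfg, rfl⟩
      exact ⟨⟨(f, g), Submodule.mem_sup_left hfg⟩, hfg, rfl⟩
    · rintro ⟨⟨⟨f, g⟩, hp⟩, hfg, rfl⟩
      exact ⟨f, g, hfg, rfl⟩
  · rw [ran_shift_eq_map] at h ⊢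
    rw [Submodule.map_sup]
    exact Submodule.isClosed_sup_finiteDimensional _ _ h

/-- An extension of `A` by a finite-dimensional space has the same eigenvalues of infinite
multiplicity as `A`. -/
theorem infPointSpec_sup {A F : LinRel H} [FiniteDimensional ℂ F] :
    infPointSpec (A ⊔ F) = infPointSpec A := by
  have key : ∀ T : LinRel H, infPointSpec T = {ζ | Cardinal.aleph0 ≤ mult T ζ} := by
    intro T
    ext ζ
    refine ⟨And.right, fun h => ⟨pointSpec_of_mult_ne_zero fun h0 => ?_, h⟩⟩
    rw [Set.mem_ofPred_eq, h0] at h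
    exact absurd h (not_le.2 Cardinal.aleph0_pos)
  rw [key, key]
  ext ζ
  simp only [Set.mem_ofPred_eq]
  refine ⟨fun h => ?_, fun h => h.trans (mult_mono le_sup_left ζ)⟩
  by_contra hA
  rw [mult_eq_rank_defSpace, not_le, Module.rank_lt_aleph0_iff] at hA
  rw [mult_eq_rank_defSpace, ← not_lt, Module.rank_lt_aleph0_iff] at h
  apply h
  have hle : defSpace (A ⊔ F) ζ ≤ A ⊔ F := inf_le_left
  have := finiteDimensional_quotient_sup A F
  -- The map from the eigenspace to `(A + F) / A` has the eigenspace of `A` as its kernel.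
  let φ : defSpace (A ⊔ F) ζ →ₗ[ℂ] (↥(A ⊔ F) ⧸ A.comap (A ⊔ F).subtype) :=
    (Submodule.mkQ _).comp (Submodule.inclusion hle)
  have hker : ∀ p : LinearMap.ker φ, ((p : defSpace (A ⊔ F) ζ) : H × H) ∈ defSpace A ζ := by
    rintro ⟨⟨⟨f, g⟩, hp⟩, hφ⟩
    have h1 : (f, g) ∈ A := 
      (Submodule.Quotient.mk_eq_zero (A.comap (A ⊔ F).subtype)).1 (LinearMap.mem_ker.1 hφ)
    exact mem_defSpace.2 ⟨h1, (mem_defSpace.1 hp).2⟩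
  let ι : LinearMap.ker φ →ₗ[ℂ] defSpace A ζ :=
    LinearMap.codRestrict _ ((Submodule.subtype _).comp (Submodule.subtype _)) hker
  have hι : Function.Injective ι := fun a b hab =>
    Subtype.ext (Subtype.ext (congrArg (Subtype.val : defSpace A ζ → H × H) hab))
  have h1 : FiniteDimensional ℂ (LinearMap.ker φ) := FiniteDimensional.of_injective ι hι
  have h2 : FiniteDimensional ℂ (LinearMap.range φ) := inferInstance
  rw [← Module.rank_lt_aleph0_iff, ← LinearMap.rank_range_add_rank_ker φ]
  exact Cardinal.add_lt_aleph0 (Module.rank_lt_aleph0 ℂ _) (Module.rank_lt_aleph0 ℂ _)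

/-! ### The extension `A ∔ N_α(A*)` at a real quasi-regular point -/

theorem mem_extS {A : LinRel H} {α : ℝ} {p : H × H} :
    p ∈ extS A α ↔ ∃ f g n, (f, g) ∈ A ∧ (n, (α : ℂ) • n) ∈ adj A ∧
      p = (f + n, g + (α : ℂ) • n) := by
  rw [extS, Submodule.mem_sup]
  constructor
  · rintro ⟨⟨f, g⟩, hfg, ⟨n, k⟩, hn, rfl⟩
    obtain ⟨hn, rfl⟩ := mem_defSpace.1 hn
    exact ⟨f, g, n, hfg, hn, rfl⟩
  · rintro ⟨f, g, n, hfg, hn, rfl⟩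
    exact ⟨(f, g), hfg, (n, (α : ℂ) • n), mem_defSpace.2 ⟨hn, rfl⟩, rfl⟩

theorem defSpace_adj_le_extS (A : LinRel H) (α : ℝ) : defSpace (adj A) α ≤ extS A α :=
  le_sup_right

theorem le_extS (A : LinRel H) (α : ℝ) : A ≤ extS A α := le_sup_left

/-- The vectors of `ker (A* - α I)` are orthogonal to `ran (A - α I)`. -/
theorem inner_of_mem_adj {A : LinRel H} {α : ℝ} {f g n : H} (hfg : (f, g) ∈ A)
    (hn : (n, (α : ℂ) • n) ∈ adj A) : inner ℂ n (g - (α : ℂ) • f) = 0 := by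
  have := (mem_adj _ _ _).1 hn f g hfg
  rw [inner_smul_left, Complex.conj_ofReal] at this
  rw [inner_sub_right, inner_smul_right, this, sub_self]

theorem disjoint_defSpace_adj {A : LinRel H} {α : ℝ} (hα : (α : ℂ) ∈ quasiRegular A) :
    Disjoint A (defSpace (adj A) α) := by
  rw [Submodule.disjoint_def]
  rintro ⟨f, g⟩ hfg h
  obtain ⟨-, rfl⟩ := mem_defSpace.1 h
  have h1 : f ∈ ker (shift A α) := mem_ker_shift.2 hfg
  rw [ker_shift_eq_bot_of_mem_quasiRegular hα, Submodule.mem_bot] at h1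
  simp [h1]

/-- `S_α` is selfadjoint: if `(h, k) ∈ S_α*`, then `k - α h` is orthogonal to `ker (A* - α I)` and
so equals `g - α f` for some `(f, g) ∈ A`, while `(h - f, k - g) ∈ N_α(A*)`. -/
theorem selfAdj_extS [CompleteSpace H] {A : LinRel H} (hA : IsClosed (A : Set (H × H)))
    (hsymm : A ≤ adj A) {α : ℝ} (hα : (α : ℂ) ∈ quasiRegular A) : SelfAdj (extS A α) := by
  refine le_antisymm ?_ ?_
  · intro p hp
    obtain ⟨f, g, n, hfg, hn, rfl⟩ := mem_extS.1 hp
    rw [mem_adj]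
    intro f' g' hp'
    obtain ⟨a, b, n', hab, hn', h⟩ := mem_extS.1 hp'
    obtain ⟨rfl, rfl⟩ := Prod.mk.inj h
    have h1 := (mem_adj _ _ _).1 (hsymm hfg) a b hab
    have h2 := (mem_adj _ _ _).1 hn a b hab
    have h3 := (mem_adj _ _ _).1 hn' f g hfg
    rw [← inner_conj_symm n' g, ← inner_conj_symm _ f, (starRingEnd ℂ).injective.eq_iff] at h3
    simp only [inner_add_left, inner_add_right, inner_smul_left, inner_smul_right,
      Complex.conj_ofReal] at h1 h2 h3 ⊢
    rw [h1, h2, ← h3, mul_add]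
  · rintro ⟨h, k⟩ hhk
    have hhkA : (h, k) ∈ adj A := adj_anti (le_extS A α) hhk
    have hcl := isClosed_ran_shift hA hα
    have : CompleteSpace (ran (shift A α)) := hcl.completeSpace_coe
    have hmem : k - (α : ℂ) • h ∈ ran (shift A α) := by
      rw [← Submodule.orthogonal_orthogonal (ran (shift A (α : ℂ))),
        Submodule.mem_orthogonal']
      intro n hn
      rw [← Complex.conj_ofReal α, ← ker_shift_adj, mem_ker_shift] at hn
      have := (mem_adj _ _ _).1 hhk n _
        (defSpace_adj_le_extS A α (mem_defSpace.2 ⟨hn, rfl⟩))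
      rw [inner_smul_right] at this
      rw [inner_sub_left, inner_smul_left, Complex.conj_ofReal, this, sub_self]
    obtain ⟨f, g, hfg, heq⟩ := mem_ran_shift.1 hmem
    have hk : k - g = (α : ℂ) • (h - f) := by
      rw [smul_sub, sub_eq_sub_iff_sub_eq_sub, ← heq]
    refine mem_extS.2 ⟨f, g, h - f, hfg, ?_, ?_⟩
    · rw [← hk]
      exact (adj A).sub_mem hhkA (hsymm hfg)
    · rw [← hk, add_sub_cancel, add_sub_cancel]

theorem mult_extS {A : LinRel H} (hsymm : A ≤ adj A) (α : ℝ) :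
    mult (extS A α) α = mult (adj A) α := by
  refine le_antisymm (mult_mono (sup_le hsymm inf_le_left) _) ?_
  rw [mult_eq_rank_defSpace, mult_eq_rank_defSpace]
  refine Submodule.rank_mono ?_
  rintro ⟨f, g⟩ h
  exact mem_defSpace.2 ⟨defSpace_adj_le_extS A α h, (mem_defSpace.1 h).2⟩

/-- A selfadjoint extension of `A` for which `α` has the full, finite multiplicity contains
`S_α`, hence equals it. -/
theorem eq_extS_of_mult_eq [CompleteSpace H] {A T : LinRel H} (hA : IsClosed (A : Set (H × H)))
    (hsymm : A ≤ adj A) {α : ℝ} (hα : (α : ℂ) ∈ quasiRegular A)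
    (hfin : mult (adj A) α < Cardinal.aleph0) (hAT : A ≤ T) (hT : SelfAdj T)
    (hmult : mult T α = mult (adj A) α) : T = extS A α := by
  have hTA : T ≤ adj A := by
    rw [hT]
    exact adj_anti hAT
  have hle : defSpace T α ≤ defSpace (adj A) α := inf_le_inf_right _ hTA
  rw [mult_eq_rank_defSpace] at hfin
  rw [mult_eq_rank_defSpace, mult_eq_rank_defSpace] at hmult
  have : FiniteDimensional ℂ (defSpace (adj A) α) := Module.rank_lt_aleph0_iff.1 hfin
  have heq : defSpace T α = defSpace (adj A) α :=
    Submodule.eq_of_le_of_finrank_eq hle (congrArg Cardinal.toNat hmult)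
  have h1 : extS A α ≤ T := sup_le hAT (heq ▸ inf_le_left)
  refine le_antisymm ?_ h1
  rw [selfAdj_extS hA hsymm hα, hT]
  exact adj_anti h1

/-- `dim ker (A* - ζ I)` is the same at all quasi-regular points, if one of them is real. -/
theorem mult_adj_eq [CompleteSpace H] {A : LinRel H} (hA : IsClosed (A : Set (H × H)))
    (hsymm : A ≤ adj A) {α : ℝ} (hα : (α : ℂ) ∈ quasiRegular A) {ζ : ℂ}
    (hζ : ζ ∈ quasiRegular A) : mult (adj A) ζ = mult (adj A) α := by
  have hζ' : starRingEnd ℂ ζ ∈ quasiRegular A := by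
    by_cases him : ζ.im = 0
    · rwa [Complex.conj_eq_iff_im.2 him]
    · exact mem_quasiRegular_of_im_ne_zero hsymm (by simpa using him)
  rw [mult, mult, ker_shift_adj, ker_shift_adj, Complex.conj_ofReal,
    rank_orthogonal_ran_eq hA hsymm hα hζ']

theorem rank_orthogonal_ran_eq_mult_adj (A : LinRel H) (x : ℝ) :
    Module.rank ℂ (ran (shift A (x : ℂ)))ᗮ = mult (adj A) x := by
  rw [mult, ker_shift_adj, Complex.conj_ofReal]

/-- The part in `ρ̂(A)` of the real spectrum of a selfadjoint extension of `A` consists of isolated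
eigenvalues, if the index is finite. -/
theorem mem_pointSpec_and_isolatedInSpec [CompleteSpace H] {A T : LinRel H}
    (hA : IsClosed (A : Set (H × H))) (hAT : A ≤ T) (hT : SelfAdj T) {x : ℝ}
    (hx : (x : ℂ) ∈ quasiRegular A) (hfin : mult (adj A) x < Cardinal.aleph0)
    (hspec : (x : ℂ) ∈ spec T) :
    (x : ℂ) ∈ pointSpec T ∧ IsolatedInSpec T x ∧ mult T x ≤ mult (adj A) x := by
  have hran : IsClosed (ran (shift T x) : Set H) :=
    isClosed_ran_shift_of_le hAT (isClosed_ran_shift hA hx)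
      (by rwa [rank_orthogonal_ran_eq_mult_adj])
  refine ⟨?_, hT.isolatedInSpec hran hspec, mult_mono ?_ _⟩
  · by_contra h
    exact hspec (hT.mem_regular_of_isClosed_ran hran h)
  · rw [hT]
    exact adj_anti hAT

/-- `S_α` has the same essential spectrum as `A`: neither part of the essential spectrum changes
under a finite-dimensional extension. -/
theorem essSpec_extS [CompleteSpace H] {A : LinRel H} (hA : IsClosed (A : Set (H × H)))
    (hsymm : A ≤ adj A) {α : ℝ} (hα : (α : ℂ) ∈ quasiRegular A)
    (hfin : mult (adj A) α < Cardinal.aleph0) : essSpec (extS A α) = essSpec A := by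
  rw [mult_eq_rank_defSpace] at hfin
  have : FiniteDimensional ℂ (defSpace (adj A) α) := Module.rank_lt_aleph0_iff.1 hfin
  have hcl := (selfAdj_extS hA hsymm hα).isClosed
  rw [essSpec, essSpec, extS, infPointSpec_sup, contSpec_sup hA hcl]

/-! ### Semi-bounds -/

/-- The form inequality `s (T - α I) ≥ c`. With `s = 1` it bounds `T` below by `α + c`, with
`s = -1` it bounds `T` above by `α - c`. -/
def FormBound (T : LinRel H) (s α c : ℝ) : Prop :=
  ∀ p ∈ T, c * ‖p.1‖ ^ 2 ≤ s * (inner ℂ p.1 (p.2 - (α : ℂ) • p.1)).re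

theorem re_inner_sub_smul (α : ℝ) (f g : H) :
    (inner ℂ f (g - (α : ℂ) • f)).re = (inner ℂ f g).re - α * ‖f‖ ^ 2 := by
  have h : (inner ℂ f f).re = ‖f‖ ^ 2 := inner_self_eq_norm_sq (𝕜 := ℂ) f
  rw [inner_sub_right, inner_smul_right, Complex.sub_re, Complex.re_ofReal_mul, h]

theorem FormBound.mem_quasiRegular {T : LinRel H} {s α c : ℝ} (hs : |s| = 1) (hc : 0 < c)
    (h : FormBound T s α c) : (α : ℂ) ∈ quasiRegular T := by
  refine LinRel.mem_quasiRegular.2 ⟨c⁻¹, inv_pos.2 hc, fun f g hfg => ?_⟩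
  have h1 : c * ‖f‖ ^ 2 ≤ ‖f‖ * ‖g - (α : ℂ) • f‖ := by
    refine (h _ hfg).trans ((le_abs_self _).trans ?_)
    rw [abs_mul, hs, one_mul]
    exact (Complex.abs_re_le_norm _).trans (norm_inner_le_norm _ _)
  rw [inv_mul_eq_div, le_div_iff₀ hc]
  rcases (norm_nonneg f).eq_or_lt with h0 | h0
  · rw [← h0, zero_mul]
    exact norm_nonneg _
  · refine le_of_mul_le_mul_left ?_ h0
    linarith

/-- The form of `S_α - α I` at `(f + n, g + α n)` is that of `A - α I` at `(f, g)`. -/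
theorem FormBound.extS {A : LinRel H} {s α c : ℝ} (hc : 0 ≤ c)
    (h : FormBound A s α c) : FormBound (extS A α) s α 0 := by
  intro p hp
  obtain ⟨f, g, n, hfg, hn, rfl⟩ := mem_extS.1 hp
  have h1 : g + (α : ℂ) • n - (α : ℂ) • (f + n) = g - (α : ℂ) • f := by module
  rw [zero_mul, h1, inner_add_left, inner_of_mem_adj hfg hn, add_zero]
  exact le_trans (by positivity) (h _ hfg)

/-- The form of `T - α I` vanishes at an eigenvector for `α`, so no strict inequality holds. -/
theorem FormBound.nonpos {T : LinRel H} {s α c : ℝ} (h : FormBound T s α c)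
    (hα : (α : ℂ) ∈ pointSpec T) : c ≤ 0 := by
  obtain ⟨f, hf, hne⟩ := Submodule.exists_mem_ne_zero_of_ne_bot hα
  have h1 := h _ (mem_ker_shift.1 hf)
  simp only [sub_self, inner_zero_right, Complex.zero_re, mul_zero] at h1
  have : 0 < ‖f‖ ^ 2 := by positivity
  nlinarith

/-- A selfadjoint relation with `s (T - α I) ≥ 0` and `α` regular satisfies a strict inequality.
With `(e, f) ∈ T - α I`, it comes from the form at `(f, g) - t (e, f)`, for a suitable `t`. -/
theorem SelfAdj.exists_formBound {T : LinRel H} (hT : SelfAdj T) {s α : ℝ} (hs : |s| = 1)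
    (h : FormBound T s α 0) (hα : (α : ℂ) ∈ regular T) : ∃ c : ℝ, 0 < c ∧ FormBound T s α c := by
  obtain ⟨hq, hran⟩ := mem_regular.1 hα
  obtain ⟨C, hC, hbd⟩ := mem_quasiRegular.1 hq
  refine ⟨1 / C, by positivity, ?_⟩
  rintro ⟨f, g⟩ hfg
  obtain ⟨e, k, hek, hf⟩ := mem_ran_shift.1 (hran ▸ Submodule.mem_top : f ∈ ran (shift T α))
  have hb := hbd _ _ hek
  rw [hf] at hb
  set u := g - (α : ℂ) • f with hu
  have hsym : inner ℂ e u = inner ℂ f f := by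
    have h1 := (mem_adj _ _ _).1 (hT.le_adj hek) f g hfg
    calc inner ℂ e u = inner ℂ (k - (α : ℂ) • e) f := by
          rw [hu, inner_sub_right, inner_smul_right, inner_sub_left, inner_smul_left,
            Complex.conj_ofReal, h1]
      _ = inner ℂ f f := by rw [hf]
  have hff : (inner ℂ f f).re = ‖f‖ ^ 2 := inner_self_eq_norm_sq (𝕜 := ℂ) f
  have h2 := h _ (T.sub_mem hfg (T.smul_mem ((s / C : ℝ) : ℂ) hek))
  have h3 : s * (inner ℂ e f).re ≤ C * ‖f‖ ^ 2 := by
    refine (le_abs_self _).trans ?_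
    rw [abs_mul, hs, one_mul]
    refine (Complex.abs_re_le_norm _).trans ((norm_inner_le_norm _ _).trans ?_)
    calc ‖e‖ * ‖f‖ ≤ C * ‖f‖ * ‖f‖ := by gcongr
      _ = C * ‖f‖ ^ 2 := by ring
  have h4 : g - ((s / C : ℝ) : ℂ) • k - (α : ℂ) • (f - ((s / C : ℝ) : ℂ) • e) =
      u - ((s / C : ℝ) : ℂ) • f := by
    rw [hu, ← hf]
    module
  have h5 : (inner ℂ (f - ((s / C : ℝ) : ℂ) • e) (u - ((s / C : ℝ) : ℂ) • f)).re =
      (inner ℂ f u).re - 2 * (s / C) * ‖f‖ ^ 2 + (s / C) * ((s / C) * (inner ℂ e f).re) := by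
    simp only [inner_sub_left, inner_sub_right, inner_smul_left, inner_smul_right,
      Complex.conj_ofReal, Complex.sub_re, Complex.re_ofReal_mul, hsym, hff]
    ring
  simp only [Prod.fst_sub, Prod.snd_sub, Prod.smul_fst, Prod.smul_snd, h4, h5, zero_mul] at h2
  have hs2 : s * s = 1 := by rw [← abs_mul_abs_self, hs, one_mul]
  -- The choice `t = s / C` turns the terms in `t` into `-2 ‖f‖² / C` and at most `‖f‖² / C`.
  have h6 : s * ((inner ℂ f u).re - 2 * (s / C) * ‖f‖ ^ 2 +
      (s / C) * ((s / C) * (inner ℂ e f).re)) =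
      s * (inner ℂ f u).re - 2 * (s * s) * (1 / C * ‖f‖ ^ 2) +
        (s * s) * (1 / C ^ 2 * (s * (inner ℂ e f).re)) := by
    field_simp
  have h7 : 1 / C ^ 2 * (s * (inner ℂ e f).re) ≤ 1 / C * ‖f‖ ^ 2 := by
    calc 1 / C ^ 2 * (s * (inner ℂ e f).re) ≤ 1 / C ^ 2 * (C * ‖f‖ ^ 2) := by gcongr
      _ = 1 / C * ‖f‖ ^ 2 := by field_simp
  rw [h6, hs2] at h2
  change 1 / C * ‖f‖ ^ 2 ≤ s * (inner ℂ f u).re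
  linarith

theorem forall_norm_eq_one_iff {T : LinRel H} {s c : ℝ} :
    (∀ p ∈ T, ‖p.1‖ = 1 → c ≤ s * (inner ℂ p.1 p.2).re) ↔
      ∀ p ∈ T, c * ‖p.1‖ ^ 2 ≤ s * (inner ℂ p.1 p.2).re := by
  constructor
  · rintro h ⟨f, g⟩ hfg
    rcases eq_or_ne f 0 with rfl | hf
    · simp
    · have hpos : 0 < ‖f‖ := norm_pos_iff.2 hf
      have h1 := h _ (T.smul_mem ((‖f‖⁻¹ : ℝ) : ℂ) hfg) (by
        rw [Prod.smul_fst, norm_smul, Complex.norm_real, norm_inv, norm_norm,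
          inv_mul_cancel₀ hpos.ne'])
      rw [Prod.smul_fst, Prod.smul_snd, inner_smul_left, inner_smul_right, Complex.conj_ofReal,
        Complex.re_ofReal_mul, Complex.re_ofReal_mul] at h1
      have h2 : ‖f‖⁻¹ * (‖f‖⁻¹ * (inner ℂ f g).re) = (inner ℂ f g).re / ‖f‖ ^ 2 := by
        field_simp
      simp only [h2] at h1
      rwa [← mul_div_assoc, le_div_iff₀ (by positivity)] at h1
  · intro h p hp h1
    simpa [h1] using h p hp

theorem formBound_one_iff {T : LinRel H} {α c : ℝ} :
    FormBound T 1 α c ↔ ((α + c : ℝ) : EReal) ≤ glb T := by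
  have h1 : ((α + c : ℝ) : EReal) ≤ glb T ↔
      ∀ p ∈ T, ‖p.1‖ = 1 → α + c ≤ 1 * (inner ℂ p.1 p.2).re := by
    rw [glb, le_sInf_iff]
    constructor
    · intro h p hp hn
      rw [one_mul]
      exact EReal.coe_le_coe_iff.1 (h _ ⟨p, hp, hn, rfl⟩)
    · rintro h _ ⟨p, hp, hn, rfl⟩
      exact EReal.coe_le_coe_iff.2 (by simpa using h p hp hn)
  rw [h1, forall_norm_eq_one_iff]
  refine forall₂_congr fun p _ => ?_
  rw [re_inner_sub_smul]
  constructor <;> intro h <;> linarith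

theorem formBound_neg_one_iff {T : LinRel H} {α c : ℝ} :
    FormBound T (-1) α c ↔ lub T ≤ ((α - c : ℝ) : EReal) := by
  have h1 : lub T ≤ ((α - c : ℝ) : EReal) ↔
      ∀ p ∈ T, ‖p.1‖ = 1 → c - α ≤ -1 * (inner ℂ p.1 p.2).re := by
    rw [lub, sSup_le_iff]
    constructor
    · intro h p hp hn
      have := EReal.coe_le_coe_iff.1 (h _ ⟨p, hp, hn, rfl⟩)
      linarith
    · rintro h _ ⟨p, hp, hn, rfl⟩
      have := h p hp hn
      exact EReal.coe_le_coe_iff.2 (by linarith)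
  rw [h1, forall_norm_eq_one_iff]
  refine forall₂_congr fun p _ => ?_
  rw [re_inner_sub_smul]
  constructor <;> intro h <;> linarith

theorem lt_glb_iff {T : LinRel H} {α : ℝ} :
    (α : EReal) < glb T ↔ ∃ c : ℝ, 0 < c ∧ FormBound T 1 α c := by
  constructor
  · intro h
    obtain ⟨m, h1, h2⟩ := EReal.lt_iff_exists_real_btwn.1 h
    refine ⟨m - α, sub_pos.2 (EReal.coe_lt_coe_iff.1 h1), formBound_one_iff.2 ?_⟩
    rw [add_sub_cancel]
    exact h2.le
  · rintro ⟨c, hc, h⟩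
    exact lt_of_lt_of_le (EReal.coe_lt_coe_iff.2 (by linarith)) (formBound_one_iff.1 h)

theorem lub_lt_iff {T : LinRel H} {α : ℝ} :
    lub T < (α : EReal) ↔ ∃ c : ℝ, 0 < c ∧ FormBound T (-1) α c := by
  constructor
  · intro h
    obtain ⟨m, h1, h2⟩ := EReal.lt_iff_exists_real_btwn.1 h
    refine ⟨α - m, sub_pos.2 (EReal.coe_lt_coe_iff.1 h2), formBound_neg_one_iff.2 ?_⟩
    rw [sub_sub_cancel]
    exact h1.le
  · rintro ⟨c, hc, h⟩
    exact lt_of_le_of_lt (formBound_neg_one_iff.1 h) (EReal.coe_lt_coe_iff.2 (by linarith))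

theorem glb_eq_iff {T : LinRel H} {α : ℝ} :
    glb T = (α : EReal) ↔
      FormBound T 1 α 0 ∧ ¬ ∃ c : ℝ, 0 < c ∧ FormBound T 1 α c := by
  rw [← lt_glb_iff, formBound_one_iff, add_zero, not_lt, le_antisymm_iff, and_comm]

theorem lub_eq_iff {T : LinRel H} {α : ℝ} :
    lub T = (α : EReal) ↔
      FormBound T (-1) α 0 ∧ ¬ ∃ c : ℝ, 0 < c ∧ FormBound T (-1) α c := by
  rw [← lub_lt_iff, formBound_neg_one_iff, sub_zero, not_lt, le_antisymm_iff]

theorem isUSB_iff {T : LinRel H} :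
    IsUSB T ↔ ∃ m : ℝ, ∀ p ∈ T, (inner ℂ p.1 p.2).im = 0 ∧
      m * ‖p.1‖ ^ 2 ≤ -(inner ℂ p.1 p.2).re := by
  refine exists_congr fun m => ⟨?_, ?_⟩
  · rintro h ⟨f, g⟩ hp
    have := h (f, -g) (mem_neg.2 (by simpa using hp))
    simpa [inner_neg_right] using this
  · rintro h ⟨f, g⟩ hp
    have := h _ (mem_neg.1 hp)
    simpa [inner_neg_right] using this

theorem IsLSB.le_adj {T : LinRel H} (h : IsLSB T) : T ≤ adj T := by
  obtain ⟨m, h⟩ := h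
  exact le_adj_of_im_eq_zero fun p hp => (h p hp).1

theorem IsUSB.le_adj {T : LinRel H} (h : IsUSB T) : T ≤ adj T := by
  obtain ⟨m, h⟩ := isUSB_iff.1 h
  exact le_adj_of_im_eq_zero fun p hp => (h p hp).1

theorem FormBound.isLSB {T : LinRel H} (hsymm : T ≤ adj T) {α : ℝ} (h : FormBound T 1 α 0) :
    IsLSB T := by
  refine ⟨α, fun p hp => ⟨im_eq_zero_of_le_adj hsymm hp, ?_⟩⟩
  have := h p hp
  rw [re_inner_sub_smul] at this
  linarith

theorem FormBound.isUSB {T : LinRel H} (hsymm : T ≤ adj T) {α : ℝ} (h : FormBound T (-1) α 0) :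
    IsUSB T := by
  refine isUSB_iff.2 ⟨-α, fun p hp => ⟨im_eq_zero_of_le_adj hsymm hp, ?_⟩⟩
  have := h p hp
  rw [re_inner_sub_smul] at this
  linarith

/-- For index one, `S_α` is the only selfadjoint extension with optimal semi-bound `α`: were `α`
no eigenvalue of the extension, it would be regular and the bound could be improved. -/
theorem eq_extS_of_formBound [CompleteSpace H] {A T : LinRel H}
    (hA : IsClosed (A : Set (H × H))) (hsymm : A ≤ adj A) {s α : ℝ} (hs : |s| = 1)
    (hα : (α : ℂ) ∈ quasiRegular A) (hone : mult (adj A) α = 1) (hAT : A ≤ T) (hT : SelfAdj T)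
    (h : FormBound T s α 0) (hopt : ¬ ∃ c : ℝ, 0 < c ∧ FormBound T s α c) : T = extS A α := by
  have hfin : mult (adj A) α < Cardinal.aleph0 := by
    rw [hone]
    exact Cardinal.one_lt_aleph0
  have hev : (α : ℂ) ∈ pointSpec T := by
    by_contra hα'
    refine hopt (hT.exists_formBound hs h (hT.mem_regular_of_isClosed_ran
      (isClosed_ran_shift_of_le hAT (isClosed_ran_shift hA hα) ?_) hα'))
    rwa [rank_orthogonal_ran_eq_mult_adj]
  refine eq_extS_of_mult_eq hA hsymm hα hfin hAT hT (le_antisymm (mult_mono ?_ _) ?_)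
  · rw [hT]
    exact adj_anti hAT
  · rw [hone, Cardinal.one_le_iff_ne_zero, mult, ne_eq, Submodule.rank_eq_zero]
    exact hev

/-- The assertions on `S_α` for a single `α`, for lower (`s = 1`) and upper (`s = -1`) bounds at
once. -/
theorem extS_properties [CompleteSpace H] {A : LinRel H} (hA : IsClosed (A : Set (H × H)))
    (hsymm : A ≤ adj A) {s α : ℝ} (hs : |s| = 1) (hα : ∃ c : ℝ, 0 < c ∧ FormBound A s α c)
    {η : ℕ} (hη : mult (adj A) α = η) :
    Disjoint A (defSpace (adj A) α) ∧
      SelfAdj (extS A α) ∧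
      FormBound (extS A α) s α 0 ∧
      (η ≠ 0 → (α : ℂ) ∈ pointSpec (extS A α)) ∧
      (η ≠ 0 → ¬ ∃ c : ℝ, 0 < c ∧ FormBound (extS A α) s α c) ∧
      (∀ T : LinRel H, A ≤ T → SelfAdj T → mult T α = (η : Cardinal) → T = extS A α) ∧
      (η = 1 → ∀ T : LinRel H, A ≤ T → SelfAdj T → FormBound T s α 0 →
        (¬ ∃ c : ℝ, 0 < c ∧ FormBound T s α c) → T = extS A α) ∧
      (∀ x : ℝ, (∃ c : ℝ, 0 < c ∧ FormBound A s x c) → (x : ℂ) ∈ spec (extS A α) →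
        (x : ℂ) ∈ pointSpec (extS A α) ∧ IsolatedInSpec (extS A α) x ∧
          mult (extS A α) x ≤ (η : Cardinal)) ∧
      mult (extS A α) α = (η : Cardinal) ∧
      essSpec (extS A α) = essSpec A := by
  obtain ⟨c, hc, hbd⟩ := hα
  have hq := hbd.mem_quasiRegular hs hc
  have hfin : mult (adj A) α < Cardinal.aleph0 := hη ▸ Cardinal.natCast_lt_aleph0
  have hmult : mult (extS A α) α = (η : Cardinal) := (mult_extS hsymm α).trans hη
  have hev : η ≠ 0 → (α : ℂ) ∈ pointSpec (extS A α) := fun h0 =>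
    pointSpec_of_mult_ne_zero (by rw [hmult]; exact_mod_cast h0)
  refine ⟨disjoint_defSpace_adj hq, selfAdj_extS hA hsymm hq, hbd.extS hc.le, hev, ?_, ?_, ?_, ?_,
    hmult, essSpec_extS hA hsymm hq hfin⟩
  · rintro h0 ⟨c', hc', h⟩
    exact absurd (h.nonpos (hev h0)) (not_le.2 hc')
  · intro T hAT hT h
    exact eq_extS_of_mult_eq hA hsymm hq hfin hAT hT (h.trans hη.symm)
  · rintro rfl T hAT hT h hopt
    exact eq_extS_of_formBound hA hsymm hs hq (by simpa using hη) hAT hT h hopt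
  · rintro x ⟨c', hc', hx⟩ hspec
    have hxq := hx.mem_quasiRegular hs hc'
    have hxη : mult (adj A) x = η := (mult_adj_eq hA hsymm hq hxq).trans hη
    rw [← hxη]
    exact mem_pointSpec_and_isolatedInSpec hA (le_extS A α) (selfAdj_extS hA hsymm hq) hxq
      (hxη ▸ Cardinal.natCast_lt_aleph0) hspec

end LinRel

theorem mainTheorem4 {H : Type*} [NormedAddCommGroup H] [InnerProductSpace ℂ H] [CompleteSpace H]
    (A : LinRel H) (hA : IsClosed (A : Set (H × H)))
    (ζ₀ : ℂ) (hζ₀ : ζ₀ ∈ LinRel.quasiRegular A)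
    (η : ℕ) (hη : Module.rank ℂ (LinRel.defSpace (LinRel.adj A) ζ₀) = (η : Cardinal)) :
    (LinRel.IsLSB A →
      (∀ α : ℝ, (α : EReal) < LinRel.glb A →
        Disjoint A (LinRel.defSpace (LinRel.adj A) α) ∧
        -- item (i)
        (A ≤ LinRel.extS A α ∧
          LinRel.SelfAdj (LinRel.extS A α) ∧
          LinRel.IsLSB (LinRel.extS A α) ∧
          (η ≠ 0 → LinRel.glb (LinRel.extS A α) = (α : EReal)) ∧
          (∀ T : LinRel H, A ≤ T → LinRel.SelfAdj T → LinRel.mult T α = (η : Cardinal) →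
            T = LinRel.extS A α) ∧
          (η = 1 → ∀ T : LinRel H, A ≤ T → LinRel.SelfAdj T → LinRel.IsLSB T →
            LinRel.glb T = (α : EReal) → T = LinRel.extS A α)) ∧
        -- item (ii)
        ((∀ x : ℝ, α ≤ x → (x : EReal) < LinRel.glb A →
            (x : ℂ) ∈ LinRel.spec (LinRel.extS A α) →
            (x : ℂ) ∈ LinRel.pointSpec (LinRel.extS A α) ∧
            LinRel.IsolatedInSpec (LinRel.extS A α) x ∧
            LinRel.mult (LinRel.extS A α) x ≤ (η : Cardinal)) ∧
          (η ≠ 0 → (α : ℂ) ∈ LinRel.pointSpec (LinRel.extS A α)) ∧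
          LinRel.mult (LinRel.extS A α) α = (η : Cardinal))) ∧
      -- item (iii)
      (∀ α₁ α₂ : ℝ, (α₁ : EReal) < LinRel.glb A → (α₂ : EReal) < LinRel.glb A →
        LinRel.essSpec (LinRel.extS A α₁) = LinRel.essSpec (LinRel.extS A α₂))) ∧
    (LinRel.IsUSB A →
      (∀ α : ℝ, LinRel.lub A < (α : EReal) →
        Disjoint A (LinRel.defSpace (LinRel.adj A) α) ∧
        -- item (i)
        (A ≤ LinRel.extS A α ∧
          LinRel.SelfAdj (LinRel.extS A α) ∧
          LinRel.IsUSB (LinRel.extS A α) ∧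
          (η ≠ 0 → LinRel.lub (LinRel.extS A α) = (α : EReal)) ∧
          (∀ T : LinRel H, A ≤ T → LinRel.SelfAdj T → LinRel.mult T α = (η : Cardinal) →
            T = LinRel.extS A α) ∧
          (η = 1 → ∀ T : LinRel H, A ≤ T → LinRel.SelfAdj T → LinRel.IsUSB T →
            LinRel.lub T = (α : EReal) → T = LinRel.extS A α)) ∧
        -- item (ii)
        ((∀ x : ℝ, x ≤ α → LinRel.lub A < (x : EReal) →
            (x : ℂ) ∈ LinRel.spec (LinRel.extS A α) →
            (x : ℂ) ∈ LinRel.pointSpec (LinRel.extS A α) ∧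
            LinRel.IsolatedInSpec (LinRel.extS A α) x ∧
            LinRel.mult (LinRel.extS A α) x ≤ (η : Cardinal)) ∧
          (η ≠ 0 → (α : ℂ) ∈ LinRel.pointSpec (LinRel.extS A α)) ∧
          LinRel.mult (LinRel.extS A α) α = (η : Cardinal))) ∧
      -- item (iii)
      (∀ α₁ α₂ : ℝ, LinRel.lub A < (α₁ : EReal) → LinRel.lub A < (α₂ : EReal) →
        LinRel.essSpec (LinRel.extS A α₁) = LinRel.essSpec (LinRel.extS A α₂))) := by
  have hη' : ∀ {s α : ℝ}, |s| = 1 → A ≤ LinRel.adj A →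
      (∃ c : ℝ, 0 < c ∧ LinRel.FormBound A s α c) → LinRel.mult (LinRel.adj A) α = η := by
    rintro s α hs hsymm ⟨c, hc, h⟩
    rw [← hη, ← LinRel.mult_eq_rank_defSpace]
    exact (LinRel.mult_adj_eq hA hsymm (h.mem_quasiRegular hs hc) hζ₀).symm
  constructor
  · intro hlsb
    have hsymm := hlsb.le_adj
    have main := fun {α : ℝ} (hα : (α : EReal) < LinRel.glb A) =>
      LinRel.extS_properties hA hsymm abs_one (LinRel.lt_glb_iff.1 hα)
        (hη' abs_one hsymm (LinRel.lt_glb_iff.1 hα))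
    refine ⟨fun α hα => ?_, fun α₁ α₂ h₁ h₂ => ?_⟩
    · obtain ⟨hdisj, hsa, hbd, hev, hopt, huniq, hone, hspec, hmult, -⟩ := main hα
      exact ⟨hdisj,
        ⟨LinRel.le_extS A α, hsa, hbd.isLSB hsa.le_adj,
          fun h0 => LinRel.glb_eq_iff.2 ⟨hbd, hopt h0⟩, huniq,
          fun h1 T hAT hT _ hglb =>
            hone h1 T hAT hT (LinRel.glb_eq_iff.1 hglb).1 (LinRel.glb_eq_iff.1 hglb).2⟩,
        fun x _ hx => hspec x (LinRel.lt_glb_iff.1 hx), hev, hmult⟩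
    · obtain ⟨-, -, -, -, -, -, -, -, -, e₁⟩ := main h₁
      obtain ⟨-, -, -, -, -, -, -, -, -, e₂⟩ := main h₂
      rw [e₁, e₂]
  · intro husb
    have hsymm := husb.le_adj
    have hs : |(-1 : ℝ)| = 1 := by rw [abs_neg, abs_one]
    have main := fun {α : ℝ} (hα : LinRel.lub A < (α : EReal)) =>
      LinRel.extS_properties hA hsymm hs (LinRel.lub_lt_iff.1 hα)
        (hη' hs hsymm (LinRel.lub_lt_iff.1 hα))
    refine ⟨fun α hα => ?_, fun α₁ α₂ h₁ h₂ => ?_⟩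
    · obtain ⟨hdisj, hsa, hbd, hev, hopt, huniq, hone, hspec, hmult, -⟩ := main hα
      exact ⟨hdisj,
        ⟨LinRel.le_extS A α, hsa, hbd.isUSB hsa.le_adj,
          fun h0 => LinRel.lub_eq_iff.2 ⟨hbd, hopt h0⟩, huniq,
          fun h1 T hAT hT _ hlub =>
            hone h1 T hAT hT (LinRel.lub_eq_iff.1 hlub).1 (LinRel.lub_eq_iff.1 hlub).2⟩,
        fun x _ hx => hspec x (LinRel.lub_lt_iff.1 hx), hev, hmult⟩
    · obtain ⟨-, -, -, -, -, -, -, -, -, e₁⟩ := main h₁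
      obtain ⟨-, -, -, -, -, -, -, -, -, e₂⟩ := main h₂
      rw [e₁, e₂]
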